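/- An ideal on $\omega=\{0,1,2,\dots\}$ is a family $\mathcal{I}\subseteq\mathcal{P}(\omega)$ closed under taking subsets and finite unions; ideals are assumed to be admissible, that is, $\omega\notin\mathcal{I}$ and every finite subset of $\omega$ belongs to $\mathcal{I}$. Identifying subsets of $\omega$ with their characteristic functions, regard $\mathcal{I}$ as a subset of the Cantor space $\{0,1\}^\omega$; $\mathcal{I}$ is a $\Sigma^0_3$-ideal (or $G_{\delta\sigma}$-ideal) if it is a countable union of $G_\delta$ subsets of $\{0,1\}^\omega$. For a topological space $X$ and a sequence $\boldsymbol{x}=(x_n)\in X^\omega$, let $\Lambda_{\boldsymbol{x}}(\mathcal{I})$ be the set of $\mathcal{I}$-limit points of $\boldsymbol{x}$, i.e. of all $\eta\in X$ for which there is a subsequence $(x_{n_k})$ (with $n_0<n_1<\cdots$) such that $\lim_{k\to\infty}x_{n_k}=\eta$ and $\{n_k:k\in\omega\}\notin\mathcal{I}$. Put $$\mathscr{L}_X(\mathcal{I}):=\{A\subseteq X: A=\Lambda_{\boldsymbol{x}}(\mathcal{I})\text{ for some }\boldsymbol{x}\in X^\omega\}\cup\{\emptyset\}.$$ **Theorem.**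 Let $X$ be a first countable topological space (not necessarily Hausdorff) and let $\mathcal{I}$ be a $\Sigma^0_3$-ideal on $\omega$. Then $\mathscr{L}_X(\mathcal{I})\subseteq\Pi^0_1(X)$; that is, $\Lambda_{\boldsymbol{x}}(\mathcal{I})$ is a closed subset of $X$ for every sequence $\boldsymbol{x}\in X^\omega$. -/

import Mathlib

open Filter Topology

/-- A set is `G_{δσ}` (i.e. `Σ⁰₃`) if it is a countable union of `G_δ` (i.e. `Π⁰₂`) sets. -/
def IsGdeltaSigma {Y : Type*} [TopologicalSpace Y] (S : Set Y) : Prop :=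
  ∃ G : ℕ → Set Y, (∀ n, IsGδ (G n)) ∧ S = ⋃ n, G n

/-- An ideal on `ω` (a nonempty family of subsets of `ω` closed under subsets and finite unions)
is admissible if it is proper and contains all finite sets. -/
def IsAdmissibleIdeal (I : Order.Ideal (Set ℕ)) : Prop :=
  Set.univ ∉ I ∧ ∀ S : Set ℕ, S.Finite → S ∈ I

/-- The ideal `I` regarded as a subset of the Cantor space `{0,1}^ω` (with the product topology),
through the identification of a set with its characteristic function. -/
def idealInCantor (I : Order.Ideal (Set ℕ)) : Set (ℕ → Bool) :=
  {f | {n : ℕ | f n = true} ∈ I}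

/-- `I` is a `Σ⁰₃`-ideal: an ideal which is a `G_{δσ}` subset of the Cantor space. -/
def IsSigmaThreeIdeal (I : Order.Ideal (Set ℕ)) : Prop :=
  IsGdeltaSigma (idealInCantor I)

/-- The set `Λ_x(I)` of `I`-limit points of the sequence `x`: the points `η` such that some
subsequence of `x`, whose set of indices does not belong to `I`, converges to `η`. -/
def idealLimitPoints {X : Type*} [TopologicalSpace X] (x : ℕ → X) (I : Order.Ideal (Set ℕ)) :
    Set X :=
  {η | ∃ φ : ℕ → ℕ, StrictMono φ ∧ Tendsto (fun k => x (φ k)) atTop (𝓝 η) ∧ Set.range φ ∉ I}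

/-- The family `𝓛_X(I)`: all sets of `I`-limit points of sequences in `X`, and the empty set. -/
def idealLimitFamily (X : Type*) [TopologicalSpace X] (I : Order.Ideal (Set ℕ)) :
    Set (Set X) :=
  {A | ∃ x : ℕ → X, A = idealLimitPoints x I} ∪ {∅}

/-!
The substance of the theorem is a combinatorial property of a `Σ⁰₃`-ideal `I`
(`IsSigmaThreeIdeal.exists_not_mem_finite_inter`): if `j : ℕ → ℕ` is a function all of whose
superlevel sets `{n | k ≤ j n}` are not in `I`, then some set outside `I` meets every
`{n | j n < k}` in a finite set.

Suppose that, on the contrary, every set meeting each `{n | j n < k}` in a finite set belongs to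
`I = ⋃ₘ Gₘ`, with each `Gₘ` a `G_δ` set. These sets are parametrized by the Baire space
`ℕ → Finset ℕ` (a product of discrete spaces), a family `F` coding the set
`{n | n ∈ F (j n)}`. By the Baire category theorem, the codes of members of some `Gₘ` are dense in
a cylinder, which prescribes the set on `{n | j n < k}` for some `k` and leaves it free on
`B = {n | k ≤ j n}`. Finite subsets of `B` being dense in the Cantor space over `B`, the subsets of
`B` whose union with the prescribed part is in `Gₘ` form a dense `G_δ` set. This set meets its image
under complementation, so `B` is covered by two members of `I`, which contradicts `B ∉ I`.

For the theorem, let `η` be in the closure of the `I`-limit points of `x`, and let `U k` be a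
decreasing neighbourhood basis at `η`. The property above is applied to the largest `j n ≤ n` with
`x n ∈ U (j n)`; enumerating the resulting set gives a subsequence converging to `η`.
-/

/-- The subset of `ℕ`, as a point of the Cantor space, whose trace on each fibre `j ⁻¹' {i}` is that
of the finite set `F i`. -/
def fiberwiseSet (j : ℕ → ℕ) (F : ℕ → Finset ℕ) : ℕ → Bool :=
  fun n => decide (n ∈ F (j n))

/-- The point of the Cantor space that agrees with `c` on `{n | j n < k}` and with `a` on
`{n | k ≤ j n}`. -/
def spliceBelow (j : ℕ → ℕ) (k : ℕ) (c a : ℕ → Bool) : ℕ → Bool :=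
  fun n => if j n < k then c n else a n

theorem continuous_spliceBelow (j : ℕ → ℕ) (k : ℕ) (c : ℕ → Bool) :
    Continuous (spliceBelow j k c) := by
  refine continuous_pi fun n => ?_
  unfold spliceBelow
  split_ifs
  · exact continuous_const
  · exact continuous_apply n

theorem continuous_fiberwiseSet [TopologicalSpace (Finset ℕ)] [DiscreteTopology (Finset ℕ)]
    (j : ℕ → ℕ) : Continuous (fiberwiseSet j) :=
  continuous_pi fun n =>
    (continuous_of_discreteTopology (f := fun s : Finset ℕ => decide (n ∈ s))).comp
      (continuous_apply (j n))

theorem finite_fiberwiseSet_inter (j : ℕ → ℕ) (F : ℕ → Finset ℕ) (k : ℕ) :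
    ({n | fiberwiseSet j F n = true} ∩ {n | j n < k}).Finite := by
  refine ((Set.finite_lt_nat k).biUnion fun i _ => (F i).finite_toSet).subset ?_
  rintro n ⟨hn, hk⟩
  exact Set.mem_biUnion (show j n ∈ {i | i < k} from hk) (by simpa [fiberwiseSet] using hn)

/-- Every neighbourhood of a point in a product of discrete spaces over `ℕ` contains a cylinder. -/
theorem exists_cylinder_subset {α : Type*} [TopologicalSpace α] [DiscreteTopology α]
    {U : Set (ℕ → α)} (hU : IsOpen U) {f : ℕ → α} (hf : f ∈ U) :
    ∃ k, {g : ℕ → α | ∀ i < k, g i = f i} ⊆ U := by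
  obtain ⟨s, u, hu, hsub⟩ := isOpen_pi_iff.1 hU f hf
  refine ⟨s.sup id + 1, fun g hg => hsub fun i hi => ?_⟩
  rw [hg i (Nat.lt_succ_of_le (Finset.le_sup (f := id) hi))]
  exact (hu i hi).2

/-- If the codes of members of `G` are dense in the cylinder of `F₀` of length `k`, then the points
of the Cantor space whose splice with `F₀` lies in `G` are dense. -/
theorem dense_preimage_spliceBelow [TopologicalSpace (Finset ℕ)] [DiscreteTopology (Finset ℕ)]
    (j : ℕ → ℕ) (G : Set (ℕ → Bool)) (F₀ : ℕ → Finset ℕ) (k : ℕ)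
    (hcyl : {F : ℕ → Finset ℕ | ∀ i < k, F i = F₀ i} ⊆ closure (fiberwiseSet j ⁻¹' G)) :
    Dense (spliceBelow j k (fiberwiseSet j F₀) ⁻¹' G) := by
  intro a
  set C := {F : ℕ → Finset ℕ | ∀ i < k, F i = F₀ i} with hC
  have hCopen : IsOpen C := by
    have : C = ⋂ i ∈ Set.Iio k, (fun F : ℕ → Finset ℕ => F i) ⁻¹' {F₀ i} := by
      ext F; simp [hC]
    rw [this]
    exact (Set.finite_Iio k).isOpen_biInter fun i _ =>
      (isOpen_discrete _).preimage (continuous_apply i)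
  -- Below level `k`, `a` itself is used, so that `a` can be approximated at all coordinates.
  let q : (ℕ → Finset ℕ) → (ℕ → Bool) := fun F => spliceBelow j k a (fiberwiseSet j F)
  have hq : Continuous q := (continuous_spliceBelow j k a).comp (continuous_fiberwiseSet j)
  have hqG : q '' (C ∩ fiberwiseSet j ⁻¹' G) ⊆
      spliceBelow j k (fiberwiseSet j F₀) ⁻¹' G := by
    rintro _ ⟨F, ⟨hFC, hFG⟩, rfl⟩
    have : spliceBelow j k (fiberwiseSet j F₀) (q F) = fiberwiseSet j F := by
      funext n
      by_cases h : j n < k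
      · simp [spliceBelow, fiberwiseSet, h, hFC (j n) h]
      · simp [q, spliceBelow, h]
    simpa only [Set.mem_preimage, this] using hFG
  have hCq : ∀ F ∈ C, q F ∈ closure (spliceBelow j k (fiberwiseSet j F₀) ⁻¹' G) := fun F hF =>
    closure_mono hqG (image_closure_subset_closure_image hq
      ⟨F, hCopen.inter_closure ⟨hF, hcyl hF⟩, rfl⟩)
  let A : ℕ → ℕ → Finset ℕ := fun N i =>
    if i < k then F₀ i else (Finset.range N).filter fun n => a n = true
  have hA : Tendsto (fun N => q (A N)) atTop (𝓝 a) := by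
    refine tendsto_pi_nhds.2 fun n => tendsto_const_nhds.congr' ?_
    filter_upwards [eventually_gt_atTop n] with N hN
    by_cases h : j n < k
    · simp [q, spliceBelow, h]
    · simp [q, spliceBelow, fiberwiseSet, A, h, hN]
  exact isClosed_closure.mem_of_tendsto hA
    (Eventually.of_forall fun N => hCq _ fun i hi => by simp [A, hi])

/-- Complementation of subsets of `ℕ`, as a homeomorphism of the Cantor space. -/
def cantorCompl : (ℕ → Bool) ≃ₜ (ℕ → Bool) where
  toFun a n := !a n
  invFun a n := !a n
  left_inv a := by simp
  right_inv a := by simp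
  continuous_toFun := continuous_pi fun n =>
    (continuous_of_discreteTopology (f := Bool.not)).comp (continuous_apply n)
  continuous_invFun := continuous_pi fun n =>
    (continuous_of_discreteTopology (f := Bool.not)).comp (continuous_apply n)

/-- A dense `G_δ` subset of the Cantor space contains a set together with its complement. -/
theorem exists_mem_and_compl_mem {D : Set (ℕ → Bool)} (hD : IsGδ D) (hd : Dense D) :
    ∃ a ∈ D, cantorCompl a ∈ D :=
  (hd.inter_of_Gδ hD (hD.preimage cantorCompl.continuous)
    (hd.preimage cantorCompl.isOpenMap)).nonempty

/-- `Σ⁰₃`-ideals have the `P⁺`-property, for the decreasing sequence of superlevel sets of `j`. -/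
theorem IsSigmaThreeIdeal.exists_not_mem_finite_inter {I : Order.Ideal (Set ℕ)}
    (hI : IsSigmaThreeIdeal I) (j : ℕ → ℕ) (hj : ∀ k, {n | k ≤ j n} ∉ I) :
    ∃ A : Set ℕ, A ∉ I ∧ ∀ k, (A ∩ {n | j n < k}).Finite := by
  by_contra! hcon
  obtain ⟨G, hG, hIG⟩ := hI
  let : TopologicalSpace (Finset ℕ) := ⊥
  have : DiscreteTopology (Finset ℕ) := ⟨rfl⟩
  have hmem : ∀ F : ℕ → Finset ℕ, fiberwiseSet j F ∈ idealInCantor I := by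
    intro F
    by_contra hF
    obtain ⟨k, hk⟩ := hcon {n | fiberwiseSet j F n = true} hF
    exact hk (finite_fiberwiseSet_inter j F k)
  have hcover : ⋃ m, closure (fiberwiseSet j ⁻¹' G m) = Set.univ := by
    refine Set.eq_univ_of_forall fun F => ?_
    have hF := hmem F
    rw [hIG] at hF
    obtain ⟨m, hm⟩ := Set.mem_iUnion.1 hF
    exact Set.mem_iUnion.2 ⟨m, subset_closure hm⟩
  obtain ⟨m, F₀, hF₀⟩ := nonempty_interior_of_iUnion_of_closed (fun _ => isClosed_closure) hcover
  obtain ⟨k, hk⟩ := exists_cylinder_subset isOpen_interior hF₀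
  obtain ⟨a, ha, ha'⟩ := exists_mem_and_compl_mem
    ((hG m).preimage (continuous_spliceBelow j k (fiberwiseSet j F₀)))
    (dense_preimage_spliceBelow j (G m) F₀ k (hk.trans interior_subset))
  have hGI : G m ⊆ idealInCantor I := hIG ▸ Set.subset_iUnion G m
  refine hj k (I.lower ?_ (I.sup_mem (hGI ha) (hGI ha')))
  intro n hn
  have hn' : ¬ j n < k := not_lt.2 hn
  cases h : a n
  · right; simp [spliceBelow, cantorCompl, hn', h]
  · left; simp [spliceBelow, hn', h]

theorem isClosed_idealLimitPoints {X : Type*} [TopologicalSpace X] [FirstCountableTopology X]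
    {I : Order.Ideal (Set ℕ)} (hfin : ∀ S : Set ℕ, S.Finite → S ∈ I) (hI : IsSigmaThreeIdeal I)
    (x : ℕ → X) : IsClosed (idealLimitPoints x I) := by
  classical
  refine isClosed_of_closure_subset fun η hη => ?_
  obtain ⟨U, hU⟩ := (𝓝 η).exists_antitone_basis
  let j : ℕ → ℕ := fun n => Nat.findGreatest (fun k => x n ∈ U k) n
  have hj : ∀ k, {n | k ≤ j n} ∉ I := by
    intro k hk
    obtain ⟨V, hVU, hV, hηV⟩ := mem_nhds_iff.1 (hU.1.mem_of_mem (i := k) trivial)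
    obtain ⟨ξ, hξV, φ, hφ, hlim, hφI⟩ := mem_closure_iff.1 hη V hV hηV
    obtain ⟨N, hN⟩ := eventually_atTop.1 (hlim.eventually (hV.mem_nhds hξV))
    refine hφI (I.lower ?_ (I.sup_mem hk
      (hfin (φ '' Set.Iio (max N k)) ((Set.finite_Iio _).image φ))))
    rintro _ ⟨i, rfl⟩
    by_cases hi : i < max N k
    · exact Or.inr ⟨i, hi, rfl⟩
    · left
      have hi' := max_le_iff.1 (not_lt.1 hi)
      exact Nat.le_findGreatest (hi'.2.trans hφ.le_apply) (hVU (hN i hi'.1))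
  obtain ⟨A, hAI, hA⟩ := hI.exists_not_mem_finite_inter j hj
  have hinf : A.Infinite := fun h => hAI (hfin A h)
  refine ⟨Nat.nth (· ∈ A), Nat.nth_strictMono hinf, ?_, ?_⟩
  · refine hU.1.tendsto_right_iff.2 fun k _ => ?_
    -- Level `0` carries no information, since `Nat.findGreatest` returns `0` as a default.
    have hev : ∀ᶠ i in atTop, Nat.nth (· ∈ A) i ∉ A ∩ {n | j n < k + 1} :=
      (Nat.nth_strictMono hinf).tendsto_atTop.eventually
        (Nat.cofinite_eq_atTop ▸ (hA (k + 1)).compl_mem_cofinite)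
    filter_upwards [hev] with i hi
    have hle : k + 1 ≤ j (Nat.nth (· ∈ A) i) := by
      by_contra h
      exact hi ⟨Nat.nth_mem_of_infinite hinf i, not_le.1 h⟩
    exact hU.2 (by omega) (Nat.findGreatest_of_ne_zero (m := j (Nat.nth (· ∈ A) i)) rfl (by omega))
  · exact (Nat.range_nth_of_infinite hinf).symm ▸ hAI

theorem mainTheorem2 {X : Type*} [TopologicalSpace X] [FirstCountableTopology X]
    (I : Order.Ideal (Set ℕ)) (hI : IsAdmissibleIdeal I) (hI3 : IsSigmaThreeIdeal I) :
    idealLimitFamily X I ⊆ {A : Set X | IsClosed A} := by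
  rintro A (⟨x, rfl⟩ | rfl)
  · exact isClosed_idealLimitPoints hI.2 hI3 x
  · exact isClosed_empty
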